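/- Let $\mathcal H$ be an infinite-dimensional complex Hilbert space, let ${\bf A}=(A_1,\dots,A_m)$ be an $m$-tuple of bounded self-adjoint operators on $\mathcal H$, and let $p_0,p,q$ be positive integers. Notation. For an $m$-tuple ${\bf T}=(T_1,\dots,T_m)$ of bounded operators on a Hilbert space $\mathcal L$ put $$W({\bf T})=\{(\langle T_1x,x\rangle,\dots,\langle T_mx,x\rangle): x\in\mathcal L,\ \|x\|=1\}\subseteq\mathbb C^m,$$ $$W(q:{\bf T})=\{(X^*T_1X,\dots,X^*T_mX): X:\mathbb C^q\to\mathcal L \text{ linear},\ X^*X=I_q\}\subseteq {\bf M}_q^m,$$ $$\Lambda_{p,q}({\bf T})=\{(B_1,\dots,B_m)\in{\bf M}_q^m:\ \text{there is a linear } X:\mathbb C^p\otimes\mathbb C^q\to\mathcal L \text{ with } X^*X=I_{pq} \text{ and } X^*T_jX=I_p\otimes B_j \text{ for } j=1,\dots,m\},$$ where ${\bf M}_q$ is the space of complex $q\times q$ matrices. Write ${\bf cl}$ for closure, ${\bf A}+{\bf F}=(A_1+F_1,\dots,A_m+F_m)$ and $Y^*{\bf A}Y=(Y^*A_1Y,\dots,Y^*A_mY)$.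 Let $$W_{ess}({\bf A})=\bigcap_{{\bf F}}{\bf cl}\,W({\bf A}+{\bf F}),\qquad W_{ess}(q:{\bf A})=\bigcap_{{\bf F}}{\bf cl}\,W(q:{\bf A}+{\bf F}),\qquad \Lambda^{ess}_{p,q}({\bf A})=\bigcap_{{\bf F}}{\bf cl}\,\Lambda_{p,q}({\bf A}+{\bf F}),$$ the intersections running over all $m$-tuples ${\bf F}=(F_1,\dots,F_m)$ of bounded finite rank operators on $\mathcal H$. A star-center of a subset $S$ of a real vector space is a point $c\in S$ such that $tc+(1-t)s\in S$ for all $s\in S$ and $0\le t\le1$; let $\tilde S_{r,q}({\bf A})$ be the set of star-centers of ${\bf cl}(\Lambda_{r,q}({\bf A}))$. Let $\mathcal V^\perp$ be the set of all linear isometries $Y:\mathcal K^\perp\to\mathcal H$ whose range has finite codimension in $\mathcal H$, where $\mathcal K$ runs over the subspaces of $\mathcal H$ of finite dimension at least $1$. Theorem. The set $$\Lambda^{ess}_{p,q}({\bf A})=W_{ess}(q:{\bf A})$$ is a compact convex set containing $(a_1I_q,\dots,a_mI_q)$ for all $(a_1,\dots,a_m)\in W_{ess}({\bf A})$. Consequently,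 $\Lambda^{ess}_{p,q}({\bf A})$ is independent of the choice of the positive integer $p$. Moreover, $$\Lambda^{ess}_{p,q}({\bf A})=\bigcap_{r\ge1}\tilde S_{r,q}({\bf A})=\bigcap_{r\ge1}{\bf cl}(\Lambda_{r,q}({\bf A}))=\bigcap\{{\bf cl}(\Lambda_{p_0,q}(Y^*{\bf A}Y)): Y\in\mathcal V^\perp\}.$$ -/

import Mathlib

open scoped Kronecker

namespace MatricialRange

section

variable {H : Type*} [NormedAddCommGroup H] [InnerProductSpace ℂ H] [CompleteSpace H]
variable {E : Type*} [NormedAddCommGroup E] [InnerProductSpace ℂ E] [CompleteSpace E]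
variable {m : ℕ}

/-- The compression `X* A X` of a bounded operator `A` by a linear isometry `X`
(a linear isometry between Hilbert spaces is the same as an operator with `X* X = I`). -/
noncomputable def compression (X : E →ₗᵢ[ℂ] H) (A : H →L[ℂ] H) : E →L[ℂ] E :=
  ContinuousLinearMap.adjoint X.toContinuousLinearMap ∘L A ∘L X.toContinuousLinearMap

/-- The joint numerical range
`W(A) = {(⟨A₁ x, x⟩, …, ⟨A_m x, x⟩) : ‖x‖ = 1}`. -/
def jointNumericalRange (A : Fin m → (H →L[ℂ] H)) : Set (Fin m → ℂ) :=
  {b | ∃ x : H, ‖x‖ = 1 ∧ ∀ j, b j = inner ℂ x (A j x)}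

/-- The joint `q`-matricial range: all `m`-tuples `(X* A₁ X, …, X* A_m X)` of `q × q` matrices,
where `X` is an isometry from a `q`-dimensional space (with a fixed orthonormal basis). -/
def jointQMatricialRange (q : ℕ) (A : Fin m → (H →L[ℂ] H)) :
    Set (Fin m → Matrix (Fin q) (Fin q) ℂ) :=
  {B | ∃ X : EuclideanSpace ℂ (Fin q) →ₗᵢ[ℂ] H,
    ∀ j, compression X (A j) = Matrix.toEuclideanCLM (𝕜 := ℂ) (B j)}

/-- The joint `(p,q)`-matricial range: all `m`-tuples `(B₁, …, B_m)` of `q × q` matrices such that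
`X* A_j X = I_p ⊗ B_j` for all `j`, for one isometry `X` from a `pq`-dimensional space. -/
def jointMatricialRange (p q : ℕ) (A : Fin m → (H →L[ℂ] H)) :
    Set (Fin m → Matrix (Fin q) (Fin q) ℂ) :=
  {B | ∃ X : EuclideanSpace ℂ (Fin p × Fin q) →ₗᵢ[ℂ] H,
    ∀ j, compression X (A j) =
      Matrix.toEuclideanCLM (𝕜 := ℂ) ((1 : Matrix (Fin p) (Fin p) ℂ) ⊗ₖ B j)}

/-- `F` is an operator of finite rank. -/
def IsFiniteRank (F : H →L[ℂ] H) : Prop :=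
  FiniteDimensional ℂ (LinearMap.range (F : H →ₗ[ℂ] H))

/-- The joint essential numerical range: the intersection of the closures of `W(A + F)` over all
`m`-tuples `F` of finite rank operators. -/
def essNumericalRange (A : Fin m → (H →L[ℂ] H)) : Set (Fin m → ℂ) :=
  ⋂ (F : Fin m → (H →L[ℂ] H)) (_ : ∀ j, IsFiniteRank (F j)),
    closure (jointNumericalRange (A + F))

/-- The joint essential `q`-matricial range. -/
def essQMatricialRange (q : ℕ) (A : Fin m → (H →L[ℂ] H)) :
    Set (Fin m → Matrix (Fin q) (Fin q) ℂ) :=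
  ⋂ (F : Fin m → (H →L[ℂ] H)) (_ : ∀ j, IsFiniteRank (F j)),
    closure (jointQMatricialRange q (A + F))

/-- The joint essential `(p,q)`-matricial range. -/
def essMatricialRange (p q : ℕ) (A : Fin m → (H →L[ℂ] H)) :
    Set (Fin m → Matrix (Fin q) (Fin q) ℂ) :=
  ⋂ (F : Fin m → (H →L[ℂ] H)) (_ : ∀ j, IsFiniteRank (F j)),
    closure (jointMatricialRange p q (A + F))

/-- The set of star-centers of `S`: points `c ∈ S` with `t c + (1 - t) s ∈ S` for all `s ∈ S`
and `0 ≤ t ≤ 1`. -/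
def starCenters {V : Type*} [AddCommGroup V] [Module ℝ V] (S : Set V) : Set V :=
  {c | c ∈ S ∧ StarConvex ℝ c S}

/-- An isometry `Y : Kᗮ → H`, where `K` is a subspace of `H` of finite dimension `r ≥ 1`
(`finrank` is `0` in infinite dimension), is of finite codimension
if its range has finite codimension in `H`. -/
def IsFiniteCodimIsometry (K : Submodule ℂ H) (Y : Kᗮ →ₗᵢ[ℂ] H) : Prop :=
  1 ≤ Module.finrank ℂ K ∧ FiniteDimensional ℂ (LinearMap.range Y.toLinearMap)ᗮ

end

end MatricialRange

open MatricialRange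

/-!
All the sets in the theorem equal the set `essBlockRange` of the tuples that can be compressed to,
up to an arbitrarily small error, inside the orthogonal complement of any finite-dimensional
subspace. For such a tuple one finds arbitrarily many approximate copies, supported on mutually
decoupled families of vectors. By Radon's theorem, sufficiently many of the approximating tuples
have two convex combinations with disjoint supports and the same value, and these give two exactly
equal copies of one tuple; iterating, the multiplicity does not matter.

Conversely, a tuple that occurs exactly with high multiplicity also occurs in `Kᗮ`, since some unit
vector of coefficients combines its copies into one that is orthogonal to `K`. To get from the
finite rank perturbations of `A` to `Kᗮ`, perturb each `A j` to its compression on `Kᗮ` plus a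
scalar on `K`, where the scalars form an essential numerical value of `A`: the part of a family of
vectors in `K` can then be replaced by one in `Kᗮ`.
-/

namespace MatricialRange

open Topology Matrix

lemma exists_disjoint_weights_of_not_affineIndependent {V G : Type*} [AddCommGroup V] [Module ℝ V]
    [Fintype G] {b : G → V} (hb : ¬ AffineIndependent ℝ b) :
    ∃ u ∈ stdSimplex ℝ G, ∃ v ∈ stdSimplex ℝ G, (∀ g, u g = 0 ∨ v g = 0) ∧
      ∑ g, u g • b g = ∑ g, v g • b g := by
  classical
  have weights (I : Set G) {y : V} (hy : y ∈ convexHull ℝ (b '' I)) :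
      ∃ w ∈ stdSimplex ℝ G, (∀ g ∉ I, w g = 0) ∧ ∑ g, w g • b g = y := by
    have himage : b '' I = Fintype.linearCombination ℝ b '' ((Pi.single · 1) '' I) := by
      simp [Set.image_image]
    rw [himage, ← LinearMap.image_convexHull] at hy
    obtain ⟨w, hw, rfl⟩ := hy
    have hsupp : Convex ℝ {w : G → ℝ | ∀ g ∉ I, w g = 0} := by
      intro w hw w' hw' s t _ _ _ g hg
      simp [hw g hg, hw' g hg]
    have hmem := convexHull_min (t := stdSimplex ℝ G ∩ {w | ∀ g ∉ I, w g = 0}) ?_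
      ((convex_stdSimplex ℝ G).inter hsupp) hw
    · exact ⟨w, hmem.1, hmem.2, rfl⟩
    · rintro _ ⟨g, hg, rfl⟩
      exact ⟨single_mem_stdSimplex ℝ g, fun g' hg' =>
        Pi.single_eq_of_ne (by rintro rfl; exact hg' hg) 1⟩
  obtain ⟨I, y, hyI, hyI'⟩ := Convex.radon_partition hb
  obtain ⟨u, hu, huI, huy⟩ := weights I hyI
  obtain ⟨v, hv, hvI, hvy⟩ := weights Iᶜ hyI'
  refine ⟨u, hu, v, hv, fun g => ?_, huy.trans hvy.symm⟩
  by_cases hg : g ∈ I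
  · exact .inr (hvI g (not_not.2 hg))
  · exact .inl (huI g hg)

lemma exists_normalized_relation_of_finrank_lt_card {𝕜 V ι : Type*} [RCLike 𝕜] [AddCommGroup V]
    [Module 𝕜 V] [FiniteDimensional 𝕜 V] [Fintype ι] (h : Module.finrank 𝕜 V < Fintype.card ι)
    (x : ι → V) : ∃ w : ι → 𝕜, ∑ a, ‖w a‖ ^ 2 = 1 ∧ ∑ a, w a • x a = 0 := by
  have hdep : ¬ LinearIndependent 𝕜 x := fun hx => h.not_ge hx.fintype_card_le_finrank
  obtain ⟨v, hv, a, ha⟩ := Fintype.not_linearIndependent_iff.1 hdep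
  have hv0 : WithLp.toLp 2 v ≠ 0 := fun h0 => ha (congrFun (congrArg WithLp.ofLp h0) a)
  refine ⟨(((‖WithLp.toLp 2 v‖⁻¹ : 𝕜) • WithLp.toLp 2 v : EuclideanSpace 𝕜 ι)), ?_, ?_⟩
  · rw [← EuclideanSpace.norm_sq_eq, norm_smul_inv_norm hv0, one_pow]
  · simp [mul_smul, ← Finset.smul_sum, hv]

variable {H : Type*} [NormedAddCommGroup H] [InnerProductSpace ℂ H]
variable {J ι ι' κ σ τ G : Type*}

section FormMatrix

/-- The matrix of the sesquilinear form `⟨u, T v⟩` on the family `x`. It is `X* T X` for the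
operator `X` sending the `s`-th basis vector to `x s`. -/
noncomputable def formMatrix (T : H →L[ℂ] H) (x : σ → H) : Matrix σ σ ℂ :=
  of fun s t => inner ℂ (x s) (T (x t))

lemma formMatrix_apply (T : H →L[ℂ] H) (x : σ → H) (s t : σ) :
    formMatrix T x s t = inner ℂ (x s) (T (x t)) := rfl

lemma formMatrix_one (x : σ → H) : formMatrix 1 x = gram ℂ x := rfl

lemma formMatrix_smul (T : H →L[ℂ] H) (c : ℂ) (x : σ → H) :
    formMatrix T (c • x) = ‖c‖ ^ 2 • formMatrix T x := by
  ext s t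
  simp only [formMatrix_apply, Pi.smul_apply, map_smul, inner_smul_left, inner_smul_right,
    Matrix.smul_apply, Complex.real_smul, Complex.ofReal_pow, ← Complex.mul_conj']
  ring

lemma formMatrix_sum_smul [Fintype σ] (T : H →L[ℂ] H) (x : σ → H) (W : Matrix σ τ ℂ) :
    formMatrix T (fun t => ∑ s, W s t • x s) = Wᴴ * formMatrix T x * W := by
  ext t t'
  simp only [formMatrix_apply, mul_apply, conjTranspose_apply, map_sum, map_smul, sum_inner,
    inner_sum, inner_smul_left, inner_smul_right, Finset.sum_mul, Finset.mul_sum, RCLike.star_def]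
  exact Finset.sum_congr rfl fun s _ => Finset.sum_congr rfl fun s' _ => by ring

lemma formMatrix_add {T : H →L[ℂ] H} {x y : σ → H} (hxy : ∀ s t, inner ℂ (x s) (T (y t)) = 0)
    (hyx : ∀ s t, inner ℂ (y s) (T (x t)) = 0) :
    formMatrix T (x + y) = formMatrix T x + formMatrix T y := by
  ext s t
  simp [formMatrix_apply, hxy, hyx]

lemma formMatrix_sum [Fintype G] {T : H →L[ℂ] H} {x : G → σ → H}
    (hx : Pairwise fun g h => ∀ s t, inner ℂ (x g s) (T (x h t)) = 0) :
    formMatrix T (∑ g, x g) = ∑ g, formMatrix T (x g) := by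
  ext s t
  simp only [formMatrix_apply, Finset.sum_apply, Matrix.sum_apply, map_sum, sum_inner, inner_sum]
  exact Finset.sum_congr rfl fun g _ =>
    Finset.sum_eq_single g (fun h _ hhg => hx hhg s t) (by simp)

lemma norm_formMatrix_apply_le (T : H →L[ℂ] H) {x : σ → H} {s t : σ} (hs : ‖x s‖ = 1)
    (ht : ‖x t‖ = 1) : ‖formMatrix T x s t‖ ≤ ‖T‖ :=
  calc ‖inner ℂ (x s) (T (x t))‖ ≤ ‖x s‖ * ‖T (x t)‖ := norm_inner_le_norm _ _
    _ ≤ 1 * (‖T‖ * 1) := by rw [hs, ← ht]; gcongr; exact T.le_opNorm _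
    _ = ‖T‖ := by ring

lemma formMatrix_compression [CompleteSpace H] {E : Type*} [NormedAddCommGroup E]
    [InnerProductSpace ℂ E] [CompleteSpace E] (Y : E →ₗᵢ[ℂ] H) (T : H →L[ℂ] H) (x : σ → E) :
    formMatrix (compression Y T) x = formMatrix T (Y ∘ x) := by
  ext s t
  simp [formMatrix_apply, compression, ContinuousLinearMap.adjoint_inner_right]

end FormMatrix

section Decoupled

/-- The vectors `u` and `v` are orthogonal for the inner product and for the form of every `A j`,
in both orders. -/
def Decoupled (A : J → H →L[ℂ] H) (u v : H) : Prop :=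
  inner ℂ u v = 0 ∧ ∀ j, inner ℂ u (A j v) = 0 ∧ inner ℂ v (A j u) = 0

variable {A : J → H →L[ℂ] H} {u v : H}

lemma Decoupled.symm (h : Decoupled A u v) : Decoupled A v u :=
  ⟨inner_eq_zero_symm.1 h.1, fun j => (h.2 j).symm⟩

variable [CompleteSpace H]

/-- The space spanned by the vectors `u`, `A j u` and `(A j)* u` with `u ∈ S`: its orthogonal
complement consists of the vectors decoupled from every `u ∈ S`. -/
noncomputable def decouplingSpace (A : J → H →L[ℂ] H) (S : Set H) : Submodule ℂ H :=
  Submodule.span ℂ (S ∪ ⋃ j, A j '' S ∪ ContinuousLinearMap.adjoint (A j) '' S)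

lemma finiteDimensional_decouplingSpace [Finite J] {S : Set H} (hS : S.Finite) :
    FiniteDimensional ℂ (decouplingSpace A S) :=
  FiniteDimensional.span_of_finite ℂ
    (hS.union (Set.finite_iUnion fun j => (hS.image (A j)).union (hS.image _)))

lemma mem_orthogonal_decouplingSpace {S : Set H} :
    v ∈ (decouplingSpace A S)ᗮ ↔ ∀ u ∈ S, Decoupled A u v := by
  rw [← Submodule.span_singleton_le_iff_mem, ← Submodule.isOrtho_iff_le, decouplingSpace,
    Submodule.isOrtho_comm, Submodule.isOrtho_span]
  constructor
  · intro h u hu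
    refine ⟨h (.inl hu) rfl, fun j => ⟨?_, inner_eq_zero_symm.1 (h (.inr ?_) rfl)⟩⟩
    · rw [← ContinuousLinearMap.adjoint_inner_left]
      exact h (.inr (Set.mem_iUnion.2 ⟨j, .inr ⟨u, hu, rfl⟩⟩)) rfl
    · exact Set.mem_iUnion.2 ⟨j, .inl ⟨u, hu, rfl⟩⟩
  · rintro h _ (hu | hu) _ rfl
    · exact (h _ hu).1
    · obtain ⟨j, ⟨u, huS, rfl⟩ | ⟨u, huS, rfl⟩⟩ := Set.mem_iUnion.1 hu
      · exact inner_eq_zero_symm.1 ((h u huS).2 j).2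
      · rw [ContinuousLinearMap.adjoint_inner_left]
        exact ((h u huS).2 j).1

lemma Decoupled.sum_smul_right [Fintype G] {y : G → H} (c : G → ℂ)
    (h : ∀ g, c g = 0 ∨ Decoupled A u (y g)) : Decoupled A u (∑ g, c g • y g) := by
  refine (mem_orthogonal_decouplingSpace (S := {u})).1 (Submodule.sum_mem _ fun g _ => ?_) u rfl
  obtain hc | hg := h g
  · simp [hc]
  · exact Submodule.smul_mem _ _ (mem_orthogonal_decouplingSpace.2 fun _ hw => hw ▸ hg)

end Decoupled

section BlockDiagonal

/-- The vectors `x s` are the images of the basis vectors under an isometry `X` with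
`X* A_j X = M j` for all `j`. -/
structure CompressesTo (A : J → H →L[ℂ] H) (x : σ → H) (M : J → Matrix σ σ ℂ) : Prop where
  orthonormal : Orthonormal ℂ x
  formMatrix_eq : ∀ j, formMatrix (A j) x = M j

/-- The family `x` of all vectors `x a i` realizes the direct sum of the matrices `B a j`: it is
mapped to the basis by an isometry `X` for which `X* A_j X` is block diagonal with
blocks `B a j`. -/
structure IsBlockDiagonal (A : J → H →L[ℂ] H) (x : ι → κ → H) (B : ι → J → Matrix κ κ ℂ) :
    Prop where
  compressesTo : ∀ a, CompressesTo A (x a) (B a)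
  decoupled : Pairwise fun a b => ∀ i k, Decoupled A (x a i) (x b k)

variable {A : J → H →L[ℂ] H}

lemma CompressesTo.norm_apply_le {x : σ → H} {M : J → Matrix σ σ ℂ} (h : CompressesTo A x M)
    (j : J) (s t : σ) : ‖M j s t‖ ≤ ‖A j‖ :=
  h.formMatrix_eq j ▸
    norm_formMatrix_apply_le (A j) (h.orthonormal.norm_eq_one s) (h.orthonormal.norm_eq_one t)

lemma compressesTo_unit {x : H} (hx : ‖x‖ = 1) :
    CompressesTo A (fun _ : Unit => x) fun j => of fun _ _ => inner ℂ x (A j x) :=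
  ⟨⟨fun _ => hx, fun _ _ h => (h rfl).elim⟩, fun _ => rfl⟩

lemma IsBlockDiagonal.comp_injective {x : ι → κ → H} {B : ι → J → Matrix κ κ ℂ}
    (h : IsBlockDiagonal A x B) {f : ι' → ι} (hf : f.Injective) :
    IsBlockDiagonal A (x ∘ f) (B ∘ f) :=
  ⟨fun a => h.compressesTo (f a), fun _ _ hab => h.decoupled (hf.ne hab)⟩

lemma IsBlockDiagonal.uncurry {x : G → ι → κ → H} {B : G → ι → J → Matrix κ κ ℂ}
    (h : ∀ g, IsBlockDiagonal A (x g) (B g))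
    (hx : Pairwise fun g g' => ∀ a i b k, Decoupled A (x g a i) (x g' b k)) :
    IsBlockDiagonal A (fun c : G × ι => x c.1 c.2) fun c => B c.1 c.2 where
  compressesTo c := (h c.1).compressesTo c.2
  decoupled := by
    rintro ⟨g, a⟩ ⟨g', b⟩ hne i k
    obtain rfl | hg := eq_or_ne g g'
    · exact (h g).decoupled (fun hab => hne (congrArg _ hab)) i k
    · exact hx hg a i b k

lemma IsBlockDiagonal.compressesTo_sum_smul [Fintype ι] {x : ι → κ → H}
    {B : ι → J → Matrix κ κ ℂ} (h : IsBlockDiagonal A x B) {w : ι → ℂ}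
    (hw : ∑ a, ‖w a‖ ^ 2 = 1) :
    CompressesTo A (∑ a, w a • x a) (∑ a, ‖w a‖ ^ 2 • B a) := by
  classical
  have hsum (T : H →L[ℂ] H)
      (hT : Pairwise fun a b => ∀ i k, inner ℂ (x a i) (T (x b k)) = 0) :
      formMatrix T (∑ a, w a • x a) = ∑ a, ‖w a‖ ^ 2 • formMatrix T (x a) := by
    rw [formMatrix_sum fun a b hab i k => by simp [hT hab i k]]
    simp only [formMatrix_smul]
  refine ⟨gram_eq_one_iff_orthonormal.1 ?_, fun j => ?_⟩
  · rw [← formMatrix_one, hsum 1 fun a b hab i k => (h.decoupled hab i k).1]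
    simp only [formMatrix_one, gram_eq_one_iff_orthonormal.2 (h.compressesTo _).orthonormal,
      ← Finset.sum_smul, hw, one_smul]
  · rw [hsum (A j) fun a b hab i k => ((h.decoupled hab i k).2 j).1]
    simp [(h.compressesTo _).formMatrix_eq]

lemma IsBlockDiagonal.sum_smul [CompleteSpace H] [Fintype ι] {x : ι → κ → H}
    {B : ι → J → Matrix κ κ ℂ} (h : IsBlockDiagonal A x B) {w : σ → ι → ℂ}
    (hw : ∀ c, ∑ a, ‖w c a‖ ^ 2 = 1) (hdisj : Pairwise fun c d => ∀ a, w c a = 0 ∨ w d a = 0) :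
    IsBlockDiagonal A (fun c => ∑ a, w c a • x a) fun c => ∑ a, ‖w c a‖ ^ 2 • B a where
  compressesTo c := h.compressesTo_sum_smul (hw c)
  decoupled c d hcd i k := by
    simp only [Finset.sum_apply, Pi.smul_apply]
    refine .sum_smul_right _ fun b => or_iff_not_imp_left.2 fun hb =>
      .symm (.sum_smul_right _ fun a => or_iff_not_imp_left.2 fun ha => ?_)
    refine h.decoupled ?_ k i
    rintro rfl
    exact (hdisj hcd _).elim ha hb

lemma compressesTo_uncurry_iff [DecidableEq ι] {x : ι → κ → H} {B : J → Matrix κ κ ℂ} :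
    CompressesTo A (Function.uncurry x) (fun j => (1 : Matrix ι ι ℂ) ⊗ₖ B j) ↔
      IsBlockDiagonal A x fun _ => B := by
  have hentries (j : J) : formMatrix (A j) (Function.uncurry x) = (1 : Matrix ι ι ℂ) ⊗ₖ B j ↔
      ∀ a i b k, inner ℂ (x a i) (A j (x b k)) = (1 : Matrix ι ι ℂ) a b * B j i k := by
    simp [← Matrix.ext_iff, formMatrix_apply, kroneckerMap_apply]
  constructor
  · intro h
    have hA j a i b k := (hentries j).1 (h.formMatrix_eq j) a i b k
    refine ⟨fun a => ⟨h.orthonormal.comp _ (Prod.mk_right_injective a), fun j => ?_⟩,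
      fun a b hab i k => ⟨@h.orthonormal.2 (a, i) (b, k) (by simp [hab]), fun j => ⟨?_, ?_⟩⟩⟩
    · ext i k
      simp [formMatrix_apply, hA]
    · simp [hA, hab]
    · simp [hA, hab.symm]
  · intro h
    refine ⟨⟨fun c => (h.compressesTo c.1).orthonormal.norm_eq_one c.2, ?_⟩,
      fun j => (hentries j).2 fun a i b k => ?_⟩
    · rintro ⟨a, i⟩ ⟨b, k⟩ hne
      obtain rfl | hab := eq_or_ne a b
      · exact (h.compressesTo a).orthonormal.2 fun hik => hne (congrArg _ hik)
      · exact (h.decoupled hab i k).1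
    · obtain rfl | hab := eq_or_ne a b
      · simp [← (h.compressesTo a).formMatrix_eq, formMatrix_apply]
      · simp [((h.decoupled hab i k).2 j).1, hab]

end BlockDiagonal

section BlockRange

/-- The tuples `B` for which there is an isometry `X` into `Kᗮ`, from the space with a basis
indexed by `ι × κ`, such that `X* A_j X` is the direct sum of copies of `B j`
indexed by `ι`. -/
def blockRange (ι : Type*) (A : J → H →L[ℂ] H) (K : Submodule ℂ H) :
    Set (J → Matrix κ κ ℂ) :=
  {B | ∃ x : ι → κ → H, (∀ a i, x a i ∈ Kᗮ) ∧ IsBlockDiagonal A x fun _ => B}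

/-- The tuples that are approximated by elements of `blockRange ι A K`
for every finite-dimensional `K`. -/
def essBlockRange (ι : Type*) (A : J → H →L[ℂ] H) : Set (J → Matrix κ κ ℂ) :=
  ⋂ (K : Submodule ℂ H) (_ : FiniteDimensional ℂ K), closure (blockRange ι A K)

variable {A : J → H →L[ℂ] H} {K L : Submodule ℂ H} {B C : J → Matrix κ κ ℂ}

lemma mem_essBlockRange_iff :
    B ∈ essBlockRange ι A ↔
      ∀ K : Submodule ℂ H, FiniteDimensional ℂ K → B ∈ closure (blockRange ι A K) :=
  Set.mem_iInter₂

lemma blockRange_antitone : Antitone (blockRange (κ := κ) ι A) :=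
  fun _ _ hKL _ ⟨x, hxL, hx⟩ => ⟨x, fun a i => Submodule.orthogonal_le hKL (hxL a i), hx⟩

lemma essBlockRange_subset_closure [FiniteDimensional ℂ K] :
    essBlockRange (κ := κ) ι A ⊆ closure (blockRange ι A K) :=
  Set.iInter₂_subset K ‹_›

lemma blockRange_subset_of_injective {f : ι' → ι} (hf : f.Injective) :
    blockRange (κ := κ) ι A K ⊆ blockRange ι' A K :=
  fun _ ⟨x, hxK, hx⟩ => ⟨x ∘ f, fun a => hxK (f a), hx.comp_injective hf⟩

lemma essBlockRange_subset_of_injective {f : ι' → ι} (hf : f.Injective) :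
    essBlockRange (κ := κ) ι A ⊆ essBlockRange ι' A :=
  Set.iInter₂_mono fun _ _ => closure_mono (blockRange_subset_of_injective hf)

lemma essBlockRange_subset_of_card_le [Fintype ι] [Fintype ι']
    (h : Fintype.card ι' ≤ Fintype.card ι) :
    essBlockRange (κ := κ) ι A ⊆ essBlockRange ι' A := by
  obtain ⟨f⟩ := Function.Embedding.nonempty_of_card_le h
  exact essBlockRange_subset_of_injective f.injective

lemma mem_blockRange_sup_decouplingSpace [CompleteSpace H] {S : Set H} :
    B ∈ blockRange ι A (K ⊔ decouplingSpace A S) ↔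
      ∃ x : ι → κ → H, (∀ a i, x a i ∈ Kᗮ) ∧ (∀ a i, ∀ u ∈ S, Decoupled A u (x a i)) ∧
        IsBlockDiagonal A x fun _ => B := by
  simp [blockRange, ← Submodule.inf_orthogonal, mem_orthogonal_decouplingSpace, forall_and,
    and_assoc]

lemma mem_blockRange_iff_exists_compressesTo [DecidableEq ι] :
    B ∈ blockRange ι A K ↔
      ∃ x : ι × κ → H, (∀ c, x c ∈ Kᗮ) ∧ CompressesTo A x fun j => (1 : Matrix ι ι ℂ) ⊗ₖ B j := by
  constructor
  · rintro ⟨x, hxK, hx⟩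
    exact ⟨Function.uncurry x, fun c => hxK c.1 c.2, compressesTo_uncurry_iff.2 hx⟩
  · rintro ⟨x, hxK, hx⟩
    exact ⟨Function.curry x, fun a i => hxK (a, i), compressesTo_uncurry_iff.1 (by simpa using hx)⟩

lemma mem_blockRange_unit_iff :
    B ∈ blockRange Unit A K ↔ ∃ x : κ → H, (∀ i, x i ∈ Kᗮ) ∧ CompressesTo A x B := by
  constructor
  · rintro ⟨x, hxK, hx⟩
    exact ⟨x (), hxK (), hx.compressesTo ()⟩
  · rintro ⟨x, hxK, hx⟩
    exact ⟨fun _ => x, fun _ => hxK, fun _ => hx, Subsingleton.pairwise⟩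

variable [CompleteSpace H]

lemma exists_decoupled_seq_of_mem_essBlockRange [Finite J] [Finite ι] [Finite κ]
    (hB : B ∈ essBlockRange ι A) {U : Set (J → Matrix κ κ ℂ)} (hU : U ∈ 𝓝 B)
    (K : Submodule ℂ H) [FiniteDimensional ℂ K] :
    ∃ (x : ℕ → ι → κ → H) (M : ℕ → J → Matrix κ κ ℂ), (∀ n, M n ∈ U) ∧
      (∀ n a i, x n a i ∈ Kᗮ) ∧ (∀ n, IsBlockDiagonal A (x n) fun _ => M n) ∧
      Pairwise fun n n' => ∀ a i b k, Decoupled A (x n a i) (x n' b k) := by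
  let P (x : ι → κ → H) : Prop := ∃ M ∈ U, (∀ a i, x a i ∈ Kᗮ) ∧ IsBlockDiagonal A x fun _ => M
  let r (x y : ι → κ → H) : Prop := ∀ a i b k, Decoupled A (x a i) (y b k)
  have : Std.Symm r := ⟨fun x y h b k a i => (h a i b k).symm⟩
  have extend (s : Finset (ι → κ → H)) : ∃ y, P y ∧ ∀ x ∈ s, r x y := by
    let S : Set H := ⋃ x ∈ s, Set.range (Function.uncurry x)
    have : FiniteDimensional ℂ (decouplingSpace A S) := finiteDimensional_decouplingSpace
      (s.finite_toSet.biUnion fun x _ => Set.finite_range _)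
    obtain ⟨M, hMU, hM⟩ := mem_closure_iff_nhds.1
      (essBlockRange_subset_closure (K := K ⊔ decouplingSpace A S) hB) U hU
    obtain ⟨y, hyK, hyS, hy⟩ := mem_blockRange_sup_decouplingSpace.1 hM
    exact ⟨y, ⟨M, hMU, hyK, hy⟩, fun x hx a i b k =>
      hyS b k _ (Set.mem_biUnion hx ⟨(a, i), rfl⟩)⟩
  obtain ⟨x, hx, hdec⟩ := exists_seq_of_forall_finset_exists' P r fun s _ => extend s
  choose M hMU hxK hxM using hx
  exact ⟨x, M, hMU, hxK, hxM, hdec⟩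

lemma mem_blockRange_prod_of_convex_combinations [Fintype G] [Finite ι] {x : G → ι → κ → H}
    {M : G → J → Matrix κ κ ℂ} (hxK : ∀ g a i, x g a i ∈ Kᗮ)
    (hx : ∀ g, IsBlockDiagonal A (x g) fun _ => M g)
    (hdec : Pairwise fun g g' => ∀ a i b k, Decoupled A (x g a i) (x g' b k))
    {w : σ → G → ℝ} (hw : ∀ c, w c ∈ stdSimplex ℝ G)
    (hdisj : Pairwise fun c d => ∀ g, w c g = 0 ∨ w d g = 0)
    (hB : ∀ c, ∑ g, w c g • M g = B) :
    B ∈ blockRange (σ × ι) A K := by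
  classical
  cases nonempty_fintype ι
  let v (c : σ × ι) (d : G × ι) : ℂ := if d.2 = c.2 then (√(w c.1 d.1) : ℂ) else 0
  have hv (c : σ × ι) (d : G × ι) : ‖v c d‖ ^ 2 = if d.2 = c.2 then w c.1 d.1 else 0 := by
    split_ifs with h <;> simp [v, h, Real.sq_sqrt ((hw c.1).1 d.1)]
  have hsum := (IsBlockDiagonal.uncurry hx hdec).sum_smul (w := v)
    (fun c => by simp [hv, Fintype.sum_prod_type, (hw c.1).2]) ?_
  · have hmean : (fun c => ∑ d, ‖v c d‖ ^ 2 • M d.1) = fun _ : σ × ι => B := by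
      simp [hv, Fintype.sum_prod_type, hB, ite_smul]
    refine ⟨_, fun c i => ?_, hmean ▸ hsum⟩
    rw [Finset.sum_apply]
    exact Submodule.sum_mem _ fun d _ => Submodule.smul_mem _ _ (hxK d.1 d.2 i)
  · rintro ⟨c, a⟩ ⟨c', a'⟩ hne ⟨g, b⟩
    obtain rfl | hcc' := eq_or_ne c c'
    · have haa' : a ≠ a' := fun h => hne (congrArg _ h)
      by_cases hb : b = a <;> simp [v, hb, haa']
    · exact (hdisj hcc' g).imp (by simp +contextual [v]) (by simp +contextual [v])

end BlockRange

section Multiplicity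

variable [CompleteSpace H] [Finite J] [Finite κ] {A : J → H →L[ℂ] H}

lemma essBlockRange_subset_bool_prod [Finite ι] :
    essBlockRange (κ := κ) ι A ⊆ essBlockRange (Bool × ι) A := by
  intro B hB
  refine mem_essBlockRange_iff.2 fun K _ => ?_
  have : LocallyConvexSpace ℝ (J → Matrix κ κ ℂ) :=
    inferInstanceAs (LocallyConvexSpace ℝ (J → κ → κ → ℂ))
  refine (mem_closure_iff_nhds_basis (LocallyConvexSpace.convex_basis (𝕜 := ℝ) B)).2
    fun U ⟨hU, hUconv⟩ => ?_
  obtain ⟨x, M, hMU, hxK, hx, hdec⟩ := exists_decoupled_seq_of_mem_essBlockRange hB hU K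
  let N := Module.finrank ℝ (J → Matrix κ κ ℂ) + 2
  have hdep : ¬ AffineIndependent ℝ fun g : Fin N => M g := fun h => by
    have := h.card_le_finrank_succ.trans (Nat.succ_le_succ (Submodule.finrank_le _))
    simp [N] at this
  obtain ⟨u, hu, v, hv, huv, huveq⟩ := exists_disjoint_weights_of_not_affineIndependent hdep
  refine ⟨∑ g, u g • M g, mem_blockRange_prod_of_convex_combinations (fun g : Fin N => hxK g)
    (fun g => hx g) (hdec.comp_of_injective Fin.val_injective) (w := fun c => bif c then u else v)
    (by simp [hu, hv]) ?_ (by simp [huveq]), hUconv.sum_mem (fun g _ => hu.1 g) hu.2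
      fun g _ => hMU g⟩
  simpa [Pairwise] using ⟨fun g => (huv g).symm, huv⟩

lemma essBlockRange_unit_subset_fin (n : ℕ) :
    essBlockRange (κ := κ) Unit A ⊆ essBlockRange (Fin (n + 1)) A := by
  induction n with
  | zero => exact essBlockRange_subset_of_card_le (by simp)
  | succ n ih =>
    exact ih.trans <| essBlockRange_subset_bool_prod.trans <|
      essBlockRange_subset_of_card_le (by simp)

lemma essBlockRange_unit_subset [Finite ι] :
    essBlockRange (κ := κ) Unit A ⊆ essBlockRange ι A := by
  cases nonempty_fintype ι
  exact (essBlockRange_unit_subset_fin (Fintype.card ι)).trans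
    (essBlockRange_subset_of_card_le (by simp))

theorem essBlockRange_eq_unit [Finite ι] [Nonempty ι] :
    essBlockRange (κ := κ) ι A = essBlockRange Unit A :=
  (essBlockRange_subset_of_injective (f := fun _ => Classical.arbitrary ι)
    (Function.injective_of_subsingleton _)).antisymm essBlockRange_unit_subset

end Multiplicity

section Convexity

variable [CompleteSpace H] [Finite J] [Finite κ] [Finite ι] {A : J → H →L[ℂ] H}
  {K : Submodule ℂ H} {B C : J → Matrix κ κ ℂ}

lemma smul_add_smul_mem_closure_blockRange [FiniteDimensional ℂ K] (hB : B ∈ essBlockRange ι A)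
    (hC : C ∈ closure (blockRange ι A K)) {s t : ℝ} (hs : 0 ≤ s) (ht : 0 ≤ t) (hst : s + t = 1) :
    s • B + t • C ∈ closure (blockRange ι A K) := by
  suffices h : ∀ C ∈ blockRange ι A K, s • B + t • C ∈ closure (blockRange ι A K) by
    simpa using map_mem_closure (f := (s • B + t • ·)) (by fun_prop) hC h
  rintro C ⟨y, hyK, hy⟩
  let S := Set.range (Function.uncurry y)
  have : FiniteDimensional ℂ (decouplingSpace A S) :=
    finiteDimensional_decouplingSpace (Set.finite_range _)
  refine map_mem_closure (f := (s • · + t • C)) (by fun_prop)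
    (essBlockRange_subset_closure (K := K ⊔ decouplingSpace A S) hB) fun M hM => ?_
  obtain ⟨x, hxK, hxy, hx⟩ := mem_blockRange_sup_decouplingSpace.1 hM
  have hdec (a i b k) : Decoupled A (x a i) (y b k) := (hxy a i _ ⟨(b, k), rfl⟩).symm
  refine blockRange_subset_of_injective (Prod.mk_right_injective ()) <|
    mem_blockRange_prod_of_convex_combinations (x := fun c => bif c then x else y)
      (M := fun c => bif c then M else C) (w := fun _ c => bif c then s else t)
      (by simp [hxK, hyK]) (by simp [hx, hy]) ?_ (by simp [stdSimplex, hs, ht, hst])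
      (Subsingleton.pairwise) (by simp)
  simpa [Pairwise] using ⟨fun a i b k => (hdec b k a i).symm, hdec⟩

theorem essBlockRange_subset_starCenters [FiniteDimensional ℂ K] :
    essBlockRange (κ := κ) ι A ⊆ starCenters (closure (blockRange ι A K)) :=
  fun _ hB => ⟨essBlockRange_subset_closure hB, fun _ hC _ _ hs ht hst =>
    smul_add_smul_mem_closure_blockRange hB hC hs ht hst⟩

theorem convex_essBlockRange : Convex ℝ (essBlockRange (κ := κ) ι A) :=
  fun _ hB _ hC _ _ hs ht hst => mem_essBlockRange_iff.2 fun _ _ =>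
    smul_add_smul_mem_closure_blockRange hB (essBlockRange_subset_closure hC) hs ht hst

end Convexity

section Compactness

variable {A : J → H →L[ℂ] H}

lemma isCompact_closure_blockRange [Nonempty ι] (A : J → H →L[ℂ] H) (K : Submodule ℂ H) :
    IsCompact (closure (blockRange (κ := κ) ι A K)) := by
  have hcompact : IsCompact (Set.univ.pi fun j =>
      (Metric.closedBall (0 : ℂ) ‖A j‖).matrix : Set (J → Matrix κ κ ℂ)) :=
    isCompact_univ_pi fun j => (isCompact_closedBall 0 ‖A j‖).matrix
  refine hcompact.closure_of_subset ?_
  rintro B ⟨x, -, hx⟩ j - i k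
  simpa using (hx.compressesTo (Classical.arbitrary ι)).norm_apply_le j i k

theorem isCompact_essBlockRange [Nonempty ι] : IsCompact (essBlockRange (κ := κ) ι A) :=
  (isCompact_closure_blockRange A ⊥).of_isClosed_subset
    (isClosed_biInter fun _ _ => isClosed_closure) essBlockRange_subset_closure

lemma exists_norm_eq_one_mem_orthogonal (hH : ¬ FiniteDimensional ℂ H) (K : Submodule ℂ H)
    [FiniteDimensional ℂ K] : ∃ x ∈ Kᗮ, ‖x‖ = 1 := by
  have hK : Kᗮ ≠ ⊥ := fun h => by
    have : FiniteDimensional ℂ (⊤ : Submodule ℂ H) :=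
      K.orthogonal_eq_bot_iff.1 h ▸ ‹FiniteDimensional ℂ K›
    exact hH (Module.Finite.equiv Submodule.topEquiv)
  obtain ⟨x, hxK, hx⟩ := Submodule.exists_mem_ne_zero_of_ne_bot hK
  exact ⟨(‖x‖⁻¹ : ℂ) • x, Submodule.smul_mem _ _ hxK, norm_smul_inv_norm hx⟩

lemma nonempty_essBlockRange_unit (hH : ¬ FiniteDimensional ℂ H) (A : J → H →L[ℂ] H) :
    (essBlockRange (κ := Unit) Unit A).Nonempty := by
  have : Nonempty {K : Submodule ℂ H // FiniteDimensional ℂ K} := ⟨⟨⊥, inferInstance⟩⟩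
  rw [essBlockRange, ← Set.iInter_subtype _ fun K => closure (blockRange Unit A K.1)]
  refine IsCompact.nonempty_iInter_of_directed_nonempty_isCompact_isClosed _ ?_ ?_
    (fun K => isCompact_closure_blockRange A K) fun K => isClosed_closure
  · rintro ⟨K, hK⟩ ⟨L, hL⟩
    exact ⟨⟨K ⊔ L, inferInstance⟩, closure_mono (blockRange_antitone le_sup_left),
      closure_mono (blockRange_antitone le_sup_right)⟩
  · rintro ⟨K, hK⟩
    obtain ⟨x, hxK, hx⟩ := exists_norm_eq_one_mem_orthogonal hH K
    exact Set.Nonempty.closure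
      ⟨_, mem_blockRange_unit_iff.2 ⟨_, fun _ => hxK, compressesTo_unit hx⟩⟩

end Compactness

section LargeMultiplicity

variable {A : J → H →L[ℂ] H}

lemma blockRange_bot_subset_of_lt_card [Fintype κ] [Fintype ι] {K : Submodule ℂ H}
    [FiniteDimensional ℂ K]
    (h : Fintype.card κ * Module.finrank ℂ K < Fintype.card ι) :
    blockRange (κ := κ) ι A ⊥ ⊆ blockRange Unit A K := by
  rintro B ⟨x, -, hx⟩
  have hdim : Module.finrank ℂ (κ → K) < Fintype.card ι := by
    simpa [Module.finrank_pi_fintype] using h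
  obtain ⟨w, hw, hwx⟩ := exists_normalized_relation_of_finrank_lt_card hdim
    fun a i => K.orthogonalProjectionOnto (x a i)
  refine mem_blockRange_unit_iff.2 ⟨∑ a, w a • x a, fun i => ?_, ?_⟩
  · rw [← Submodule.orthogonalProjectionOnto_eq_zero_iff]
    simpa using congrFun hwx i
  · simpa [← Finset.sum_smul, hw] using hx.compressesTo_sum_smul hw

theorem iInter_closure_blockRange_subset_essBlockRange [Finite κ] :
    ⋂ (r : ℕ) (_ : 1 ≤ r), closure (blockRange (κ := κ) (Fin r) A ⊥) ⊆ essBlockRange Unit A := by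
  cases nonempty_fintype κ
  refine Set.subset_iInter₂ fun K _ => ?_
  let r := Fintype.card κ * Module.finrank ℂ K + 1
  exact (Set.iInter₂_subset r (Nat.le_add_left 1 _)).trans
    (closure_mono (blockRange_bot_subset_of_lt_card (by simp [r])))

end LargeMultiplicity

section Isometry

variable [CompleteSpace H] {A : J → H →L[ℂ] H} {E : Type*} [NormedAddCommGroup E]
  [InnerProductSpace ℂ E] [CompleteSpace E]

lemma compressesTo_compression_iff {Y : E →ₗᵢ[ℂ] H} {x : σ → E} {M : J → Matrix σ σ ℂ} :
    CompressesTo (fun j => compression Y (A j)) x M ↔ CompressesTo A (Y ∘ x) M := by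
  constructor
  · exact fun h => ⟨h.orthonormal.comp_linearIsometry Y, fun j => by
      rw [← h.formMatrix_eq, formMatrix_compression]⟩
  · exact fun h => ⟨Y.orthonormal_comp_iff.1 h.orthonormal, fun j => by
      rw [← h.formMatrix_eq, formMatrix_compression]⟩

lemma blockRange_compression (Y : E →ₗᵢ[ℂ] H) :
    blockRange (κ := κ) ι (fun j => compression Y (A j)) ⊥ =
      blockRange ι A (LinearMap.range Y.toLinearMap)ᗮ := by
  classical
  have : CompleteSpace (LinearMap.range Y.toLinearMap) :=
    Y.isometry.isUniformInducing.isComplete_range.completeSpace_coe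
  ext B
  simp only [mem_blockRange_iff_exists_compressesTo, compressesTo_compression_iff,
    Submodule.orthogonal_orthogonal]
  constructor
  · rintro ⟨x, -, hx⟩
    exact ⟨Y ∘ x, fun c => ⟨x c, rfl⟩, hx⟩
  · rintro ⟨y, hy, hyB⟩
    choose x hx using hy
    obtain rfl : Y ∘ x = y := funext hx
    exact ⟨x, by simp, hyB⟩

lemma iInter_closure_blockRange_compression_subset (hH : ¬ FiniteDimensional ℂ H) :
    ⋂ (K : Submodule ℂ H) (Y : Kᗮ →ₗᵢ[ℂ] H) (_ : IsFiniteCodimIsometry K Y),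
      closure (blockRange (κ := κ) ι (fun j => compression Y (A j)) ⊥) ⊆ essBlockRange ι A := by
  intro B hB
  refine mem_essBlockRange_iff.2 fun K _ => ?_
  obtain ⟨v, -, hv⟩ := exists_norm_eq_one_mem_orthogonal hH K
  let L := K ⊔ ℂ ∙ v
  have hrange : LinearMap.range Lᗮ.subtypeₗᵢ.toLinearMap = Lᗮ := by simp
  have hL : IsFiniteCodimIsometry L Lᗮ.subtypeₗᵢ := by
    refine ⟨Nat.one_le_iff_ne_zero.2 fun h => ?_, ?_⟩
    · have hv0 : v ∈ L := Submodule.mem_sup_right (Submodule.mem_span_singleton_self v)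
      rw [Submodule.finrank_eq_zero.1 h, Submodule.mem_bot] at hv0
      simp [hv0] at hv
    · rw [hrange, Submodule.orthogonal_orthogonal]
      infer_instance
  have hBL := Set.mem_iInter.1 (Set.mem_iInter₂.1 hB L Lᗮ.subtypeₗᵢ) hL
  rw [blockRange_compression, hrange, Submodule.orthogonal_orthogonal] at hBL
  exact closure_mono (blockRange_antitone le_sup_left) hBL

theorem essBlockRange_eq_iInter_compression (hH : ¬ FiniteDimensional ℂ H) :
    essBlockRange (κ := κ) ι A =
      ⋂ (K : Submodule ℂ H) (Y : Kᗮ →ₗᵢ[ℂ] H) (_ : IsFiniteCodimIsometry K Y),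
        closure (blockRange ι (fun j => compression Y (A j)) ⊥) := by
  refine subset_antisymm (Set.subset_iInter fun K => Set.subset_iInter₂ fun Y hY => ?_)
    (iInter_closure_blockRange_compression_subset hH)
  have := hY.2
  rw [blockRange_compression]
  exact essBlockRange_subset_closure

end Isometry

section Scalars

variable {A : J → H →L[ℂ] H} {K : Submodule ℂ H} {a : J → Matrix Unit Unit ℂ}

lemma exists_compressesTo_smul_one [DecidableEq σ] (ha : a ∈ blockRange σ A K) :
    ∃ z : σ → H, (∀ s, z s ∈ Kᗮ) ∧ CompressesTo A z fun j => a j () () • 1 := by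
  obtain ⟨x, hxK, hx⟩ := mem_blockRange_iff_exists_compressesTo.1 ha
  refine ⟨fun s => x (s, ()), fun s => hxK _,
    hx.orthonormal.comp _ (Prod.mk_left_injective ()), fun j => ?_⟩
  ext s t
  exact (congrFun₂ (hx.formMatrix_eq j) (s, ()) (t, ())).trans (by simp [mul_comm])

variable [CompleteSpace H] [Finite J]

lemma smul_one_mem_essBlockRange [Finite σ] [DecidableEq σ] (ha : a ∈ essBlockRange Unit A) :
    (fun j => a j () () • (1 : Matrix σ σ ℂ)) ∈ essBlockRange Unit A := by
  refine mem_essBlockRange_iff.2 fun K _ =>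
    map_mem_closure (f := fun a j => a j () () • (1 : Matrix σ σ ℂ)) (by fun_prop)
      (essBlockRange_subset_closure (K := K) (essBlockRange_unit_subset (ι := σ) ha)) fun b hb => ?_
  exact mem_blockRange_unit_iff.2 (exists_compressesTo_smul_one hb)

end Scalars

section FiniteRank

lemma CompressesTo.add_sum_smul [CompleteSpace H] [Fintype σ] [DecidableEq σ] [DecidableEq τ]
    {A : J → H →L[ℂ] H}
    {y : τ → H} {z : σ → H} {c : J → ℂ} (hz : CompressesTo A z fun j => c j • 1)
    (hyz : ∀ t s, Decoupled A (y t) (z s)) {U : Matrix σ τ ℂ} (hU : gram ℂ y + Uᴴ * U = 1) :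
    CompressesTo A (y + fun t => ∑ s, U s t • z s)
      fun j => formMatrix (A j) y + c j • (Uᴴ * U) := by
  have hdec (t t' : τ) : Decoupled A (y t) (∑ s, U s t' • z s) :=
    .sum_smul_right _ fun s => .inr (hyz t s)
  refine ⟨gram_eq_one_iff_orthonormal.1 ?_, fun j => ?_⟩
  · rw [← formMatrix_one, formMatrix_add (fun t t' => (hdec t t').1)
      (fun t t' => (hdec t' t).symm.1), formMatrix_sum_smul, formMatrix_one, formMatrix_one,
      gram_eq_one_iff_orthonormal.2 hz.orthonormal, Matrix.mul_one, hU]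
  · rw [formMatrix_add (fun t t' => ((hdec t t').2 j).1) (fun t t' => ((hdec t' t).2 j).2),
      formMatrix_sum_smul, hz.formMatrix_eq, Matrix.mul_smul, Matrix.mul_one, Matrix.smul_mul]

/-- The operator that is the compression of `T` on `Kᗮ` and the scalar `c` on `K`. For
finite-dimensional `K` it differs from `T` by an operator of finite rank. -/
noncomputable def pinch (K : Submodule ℂ H) [K.HasOrthogonalProjection] (T : H →L[ℂ] H) (c : ℂ) :
    H →L[ℂ] H :=
  Kᗮ.starProjection ∘L T ∘L Kᗮ.starProjection + c • K.starProjection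

section Pinch

variable (K : Submodule ℂ H) [K.HasOrthogonalProjection]

lemma pinch_one : pinch K 1 1 = 1 := by
  have hidem : Kᗮ.starProjection ∘L Kᗮ.starProjection = Kᗮ.starProjection :=
    Submodule.isIdempotentElem_starProjection _
  rw [pinch, one_smul, ContinuousLinearMap.one_def, ContinuousLinearMap.id_comp, hidem,
    Submodule.starProjection_orthogonal, sub_add_cancel]

lemma formMatrix_pinch (T : H →L[ℂ] H) (c : ℂ) (x : σ → H) :
    formMatrix (pinch K T c) x =
      formMatrix T (Kᗮ.starProjection ∘ x) + c • gram ℂ (K.starProjection ∘ x) := by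
  have hproj (u v : H) :
      inner ℂ u (K.starProjection v) = inner ℂ (K.starProjection u) (K.starProjection v) := by
    rw [K.inner_starProjection_left_eq_right,
      Submodule.starProjection_eq_self_iff.2 (K.starProjection_apply_mem v)]
  have hcomp (u v : H) :
      inner ℂ u (pinch K T c v) = inner ℂ (Kᗮ.starProjection u) (T (Kᗮ.starProjection v)) +
        c * inner ℂ (K.starProjection u) (K.starProjection v) := by
    rw [Submodule.inner_starProjection_left_eq_right, ← hproj, ← inner_smul_right,
      ← inner_add_right]
    rfl
  ext s t
  exact hcomp (x s) (x t)

end Pinch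

lemma isFiniteRank_pinch_sub (K : Submodule ℂ H) [FiniteDimensional ℂ K] (T : H →L[ℂ] H) (c : ℂ) :
    IsFiniteRank (pinch K T c - T) := by
  have hrange : LinearMap.range (pinch K T c - T : H →ₗ[ℂ] H) ≤ K ⊔ K.map (T : H →ₗ[ℂ] H) := by
    rintro _ ⟨x, rfl⟩
    have h : (pinch K T c - T) x = (c • K.starProjection x -
        K.starProjection (T (Kᗮ.starProjection x))) + T (-K.starProjection x) := by
      simp [pinch]
      abel
    refine h ▸ Submodule.add_mem_sup ?_ (Submodule.mem_map_of_mem (K.neg_mem ?_))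
    · exact K.sub_mem (K.smul_mem _ (K.starProjection_apply_mem _)) (K.starProjection_apply_mem _)
    · exact K.starProjection_apply_mem _
  exact Submodule.finiteDimensional_of_le hrange

variable [CompleteSpace H] [Finite J] {A : J → H →L[ℂ] H}

open scoped MatrixOrder in
lemma blockRange_pinch_subset [Finite κ] {K : Submodule ℂ H} [FiniteDimensional ℂ K]
    {a : J → Matrix Unit Unit ℂ} (ha : a ∈ essBlockRange Unit A) :
    blockRange (κ := κ) Unit (fun j => pinch K (A j) (a j () ())) ⊥ ⊆
      closure (blockRange Unit A K) := by
  classical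
  cases nonempty_fintype κ
  intro B hB
  obtain ⟨x, -, hx⟩ := mem_blockRange_unit_iff.1 hB
  let y := Kᗮ.starProjection ∘ x
  have : FiniteDimensional ℂ (decouplingSpace A (Set.range y)) :=
    finiteDimensional_decouplingSpace (Set.finite_range y)
  obtain ⟨U, hU⟩ := CStarAlgebra.nonneg_iff_eq_star_mul_self.mp
    (posSemidef_gram ℂ (K.starProjection ∘ x)).nonneg
  rw [star_eq_conjTranspose] at hU
  have hone : gram ℂ y + Uᴴ * U = 1 := by
    rw [← gram_eq_one_iff_orthonormal.2 hx.orthonormal, ← formMatrix_one x, ← pinch_one K,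
      formMatrix_pinch, one_smul, hU, formMatrix_one]
  obtain rfl : (fun j => formMatrix (A j) y + a j () () • (Uᴴ * U)) = B :=
    funext fun j => by rw [← hx.formMatrix_eq, formMatrix_pinch, hU]
  refine map_mem_closure (f := fun a j => formMatrix (A j) y + a j () () • (Uᴴ * U)) (by fun_prop)
    (essBlockRange_subset_closure (K := K ⊔ decouplingSpace A (Set.range y))
      (essBlockRange_unit_subset (ι := κ) ha)) fun b hb => ?_
  obtain ⟨z, hz, hzb⟩ := exists_compressesTo_smul_one hb
  simp only [← Submodule.inf_orthogonal, Submodule.mem_inf, mem_orthogonal_decouplingSpace,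
    Set.forall_mem_range] at hz
  exact mem_blockRange_unit_iff.2 ⟨_, fun i => Kᗮ.add_mem (Kᗮ.starProjection_apply_mem (x i)) <|
    Kᗮ.sum_mem fun s _ => Kᗮ.smul_mem _ (hz s).1, hzb.add_sum_smul (fun t s => (hz s).2 t) hone⟩

theorem iInter_closure_blockRange_add_subset [Finite κ] (hH : ¬ FiniteDimensional ℂ H) :
    ⋂ (F : J → H →L[ℂ] H) (_ : ∀ j, IsFiniteRank (F j)),
      closure (blockRange (κ := κ) Unit (A + F) ⊥) ⊆ essBlockRange Unit A := by
  obtain ⟨a, ha⟩ := nonempty_essBlockRange_unit hH A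
  refine Set.subset_iInter₂ fun K _ => (Set.iInter₂_subset
    (fun j => pinch K (A j) (a j () ()) - A j) fun j => isFiniteRank_pinch_sub K _ _).trans ?_
  refine closure_minimal ?_ isClosed_closure
  rw [show (A + fun j => pinch K (A j) (a j () ()) - A j) = fun j => pinch K (A j) (a j () ()) from
    add_sub_cancel _ _]
  exact blockRange_pinch_subset ha

omit [CompleteSpace H] in
lemma essBlockRange_subset_closure_blockRange_add {F : J → H →L[ℂ] H}
    (hF : ∀ j, IsFiniteRank (F j)) :
    essBlockRange (κ := κ) ι A ⊆ closure (blockRange ι (A + F) ⊥) := by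
  classical
  let K := ⨆ j, LinearMap.range (F j : H →ₗ[ℂ] H)
  have : ∀ j, FiniteDimensional ℂ (LinearMap.range (F j : H →ₗ[ℂ] H)) := hF
  refine (essBlockRange_subset_closure (K := K)).trans (closure_mono fun B hB => ?_)
  obtain ⟨x, hxK, hx⟩ := mem_blockRange_iff_exists_compressesTo.1 hB
  refine mem_blockRange_iff_exists_compressesTo.2 ⟨x, by simp, hx.orthonormal, fun j => ?_⟩
  have hFx (c d) : inner ℂ (x c) (F j (x d)) = 0 :=
    K.inner_left_of_mem_orthogonal (Submodule.mem_iSup_of_mem j ⟨x d, rfl⟩) (hxK c)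
  rw [← hx.formMatrix_eq]
  ext c d
  simp [formMatrix_apply, hFx]

end FiniteRank

section JointRanges

variable [CompleteSpace H]

lemma compression_eq_toEuclideanCLM_iff [Fintype σ] [DecidableEq σ]
    {X : EuclideanSpace ℂ σ →ₗᵢ[ℂ] H} {T : H →L[ℂ] H} {M : Matrix σ σ ℂ} :
    compression X T = toEuclideanCLM (𝕜 := ℂ) M ↔
      formMatrix T (X ∘ EuclideanSpace.basisFun σ ℂ) = M := by
  have hsymm : formMatrix (compression X T) (EuclideanSpace.basisFun σ ℂ) =
      (toEuclideanCLM (𝕜 := ℂ)).symm (compression X T) := by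
    ext s t
    exact ((compression X T).toLinearMap.toMatrixOrthonormal_apply_apply
      (EuclideanSpace.basisFun σ ℂ) s t).symm
  rw [← formMatrix_compression, hsymm]
  exact toEuclideanCLM.toEquiv.symm_apply_eq.symm

lemma exists_compression_eq_iff [Fintype σ] [DecidableEq σ] {A : J → H →L[ℂ] H}
    {M : J → Matrix σ σ ℂ} :
    (∃ X : EuclideanSpace ℂ σ →ₗᵢ[ℂ] H,
      ∀ j, compression X (A j) = toEuclideanCLM (𝕜 := ℂ) (M j)) ↔
    ∃ x : σ → H, CompressesTo A x M := by
  simp only [compression_eq_toEuclideanCLM_iff]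
  constructor
  · rintro ⟨X, hX⟩
    exact ⟨_, (EuclideanSpace.basisFun σ ℂ).orthonormal.comp_linearIsometry X, hX⟩
  · rintro ⟨x, hx⟩
    let b := (EuclideanSpace.basisFun σ ℂ).toBasis
    have hb : Orthonormal ℂ b := by simp [b]
    have hbx : b.constr ℂ x ∘ b = x := funext fun s => b.constr_basis ℂ x s
    have horth : Orthonormal ℂ (b.constr ℂ x ∘ b) := by rw [hbx]; exact hx.orthonormal
    refine ⟨(b.constr ℂ x).isometryOfOrthonormal hb horth, fun j => ?_⟩
    rw [← hx.formMatrix_eq, LinearMap.coe_isometryOfOrthonormal,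
      ← OrthonormalBasis.coe_toBasis, hbx]

variable {m : ℕ} {A : Fin m → H →L[ℂ] H}

lemma jointMatricialRange_eq_blockRange (p q : ℕ) (A : Fin m → H →L[ℂ] H) :
    jointMatricialRange p q A = blockRange (Fin p) A ⊥ := by
  ext B
  simpa [jointMatricialRange, mem_blockRange_iff_exists_compressesTo] using
    exists_compression_eq_iff (A := A) (M := fun j => (1 : Matrix (Fin p) (Fin p) ℂ) ⊗ₖ B j)

lemma jointQMatricialRange_eq_blockRange (q : ℕ) (A : Fin m → H →L[ℂ] H) :
    jointQMatricialRange q A = blockRange Unit A ⊥ := by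
  ext B
  simpa [jointQMatricialRange, mem_blockRange_unit_iff] using
    exists_compression_eq_iff (A := A) (M := B)

omit [CompleteSpace H] in
lemma mem_closure_blockRange_of_mem_closure_jointNumericalRange {a : Fin m → ℂ}
    (ha : a ∈ closure (jointNumericalRange A)) :
    (fun j => of fun _ _ : Unit => a j) ∈ closure (blockRange Unit A ⊥) := by
  refine map_mem_closure (f := fun (a : Fin m → ℂ) j => of fun _ _ : Unit => a j)
    (continuous_pi fun j => continuous_matrix fun _ _ => continuous_apply j) ha ?_
  rintro b ⟨x, hx, hb⟩
  obtain rfl : b = fun j => inner ℂ x (A j x) := funext hb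
  exact mem_blockRange_unit_iff.2 ⟨_, by simp, compressesTo_unit hx⟩

theorem essQMatricialRange_eq_essBlockRange (hH : ¬ FiniteDimensional ℂ H) (q : ℕ)
    (A : Fin m → H →L[ℂ] H) : essQMatricialRange q A = essBlockRange Unit A := by
  simp only [essQMatricialRange, jointQMatricialRange_eq_blockRange]
  exact (iInter_closure_blockRange_add_subset hH).antisymm
    (Set.subset_iInter₂ fun F hF => essBlockRange_subset_closure_blockRange_add hF)

theorem essMatricialRange_eq_essBlockRange (hH : ¬ FiniteDimensional ℂ H) {p : ℕ} (hp : 1 ≤ p)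
    (q : ℕ) (A : Fin m → H →L[ℂ] H) : essMatricialRange p q A = essBlockRange Unit A := by
  have : NeZero p := ⟨Nat.one_le_iff_ne_zero.1 hp⟩
  simp only [essMatricialRange, jointMatricialRange_eq_blockRange]
  refine subset_antisymm ?_ ?_
  · exact (Set.iInter₂_mono fun F _ => closure_mono (blockRange_subset_of_injective
      (f := fun _ : Unit => (0 : Fin p)) (Function.injective_of_subsingleton _))).trans
        (iInter_closure_blockRange_add_subset hH)
  · rw [← essBlockRange_eq_unit (ι := Fin p)]
    exact Set.subset_iInter₂ fun F hF => essBlockRange_subset_closure_blockRange_add hF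

lemma smul_one_mem_essBlockRange_of_mem_essNumericalRange (hH : ¬ FiniteDimensional ℂ H)
    [Finite σ] [DecidableEq σ] {a : Fin m → ℂ} (ha : a ∈ essNumericalRange A) :
    (fun j => a j • (1 : Matrix σ σ ℂ)) ∈ essBlockRange Unit A := by
  have hmem : (fun j => of fun _ _ : Unit => a j) ∈ essBlockRange Unit A := by
    refine iInter_closure_blockRange_add_subset hH (Set.mem_iInter₂.2 fun F hF => ?_)
    exact mem_closure_blockRange_of_mem_closure_jointNumericalRange (Set.mem_iInter₂.1 ha F hF)
  exact smul_one_mem_essBlockRange hmem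

lemma essBlockRange_subset_iInter_starCenters (q : ℕ) (A : Fin m → H →L[ℂ] H) :
    essBlockRange Unit A ⊆
      ⋂ (r : ℕ) (_ : 1 ≤ r), starCenters (closure (jointMatricialRange r q A)) := by
  refine Set.subset_iInter₂ fun r _ => ?_
  rw [jointMatricialRange_eq_blockRange]
  exact essBlockRange_unit_subset.trans essBlockRange_subset_starCenters

end JointRanges

end MatricialRange

theorem theorem4p1_general {H : Type*} [NormedAddCommGroup H] [InnerProductSpace ℂ H]
    [CompleteSpace H] (hH : ¬ FiniteDimensional ℂ H) {m : ℕ} (A : Fin m → (H →L[ℂ] H))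
    (p₀ p q : ℕ) (hp₀ : 1 ≤ p₀) (hp : 1 ≤ p) :
    essMatricialRange p q A = essQMatricialRange q A ∧
    IsCompact (essMatricialRange p q A) ∧
    Convex ℝ (essMatricialRange p q A) ∧
    (∀ a ∈ essNumericalRange A,
      (fun j => a j • (1 : Matrix (Fin q) (Fin q) ℂ)) ∈ essMatricialRange p q A) ∧
    (∀ p' : ℕ, 1 ≤ p' → essMatricialRange p' q A = essMatricialRange p q A) ∧
    essMatricialRange p q A =
      ⋂ (r : ℕ) (_ : 1 ≤ r), starCenters (closure (jointMatricialRange r q A)) ∧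
    essMatricialRange p q A =
      ⋂ (r : ℕ) (_ : 1 ≤ r), closure (jointMatricialRange r q A) ∧
    essMatricialRange p q A =
      ⋂ (K : Submodule ℂ H) (Y : Kᗮ →ₗᵢ[ℂ] H) (_ : IsFiniteCodimIsometry K Y),
        closure (jointMatricialRange p₀ q (fun j => compression Y (A j))) := by
  have hess (r : ℕ) (hr : 1 ≤ r) : essMatricialRange r q A = essBlockRange Unit A :=
    essMatricialRange_eq_essBlockRange hH hr q A
  have hstar := essBlockRange_subset_iInter_starCenters q A
  have hclosure : ⋂ (r : ℕ) (_ : 1 ≤ r), starCenters (closure (jointMatricialRange r q A)) ⊆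
      ⋂ (r : ℕ) (_ : 1 ≤ r), closure (jointMatricialRange r q A) :=
    Set.iInter₂_mono fun r _ _ hB => hB.1
  have hlarge : ⋂ (r : ℕ) (_ : 1 ≤ r), closure (jointMatricialRange r q A) ⊆
      essBlockRange Unit A := by
    simpa only [jointMatricialRange_eq_blockRange] using
      iInter_closure_blockRange_subset_essBlockRange
  have : Nonempty (Fin p₀) := ⟨⟨0, hp₀⟩⟩
  rw [hess p hp, essQMatricialRange_eq_essBlockRange hH]
  refine ⟨rfl, isCompact_essBlockRange, convex_essBlockRange,
    fun _ => smul_one_mem_essBlockRange_of_mem_essNumericalRange hH, hess,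
    hstar.antisymm (hclosure.trans hlarge), (hstar.trans hclosure).antisymm hlarge, ?_⟩
  simp only [jointMatricialRange_eq_blockRange]
  exact essBlockRange_eq_unit.symm.trans (essBlockRange_eq_iInter_compression hH)

theorem theorem4p1 {H : Type*} [NormedAddCommGroup H] [InnerProductSpace ℂ H] [CompleteSpace H]
    (hH : ¬ FiniteDimensional ℂ H) {m : ℕ} (A : Fin m → (H →L[ℂ] H))
    (hA : ∀ j, IsSelfAdjoint (A j)) (p₀ p q : ℕ) (hp₀ : 1 ≤ p₀) (hp : 1 ≤ p) (hq : 1 ≤ q) :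
    essMatricialRange p q A = essQMatricialRange q A ∧
    IsCompact (essMatricialRange p q A) ∧
    Convex ℝ (essMatricialRange p q A) ∧
    (∀ a ∈ essNumericalRange A,
      (fun j => a j • (1 : Matrix (Fin q) (Fin q) ℂ)) ∈ essMatricialRange p q A) ∧
    (∀ p' : ℕ, 1 ≤ p' → essMatricialRange p' q A = essMatricialRange p q A) ∧
    essMatricialRange p q A =
      ⋂ (r : ℕ) (_ : 1 ≤ r), starCenters (closure (jointMatricialRange r q A)) ∧
    essMatricialRange p q A =
      ⋂ (r : ℕ) (_ : 1 ≤ r), closure (jointMatricialRange r q A) ∧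
    essMatricialRange p q A =
      ⋂ (K : Submodule ℂ H) (Y : Kᗮ →ₗᵢ[ℂ] H) (_ : IsFiniteCodimIsometry K Y),
        closure (jointMatricialRange p₀ q (fun j => compression Y (A j))) :=
  theorem4p1_general hH A p₀ p q hp₀ hp
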